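/- Let $\mathbb{G}=(A,\Delta)$ be a compact quantum group: $A\neq 0$ is a unital $C^*$-algebra and $\Delta:A\to A\otimes A$ (minimal tensor product) is a unital $*$-homomorphism with $(\Delta\otimes\mathrm{id})\Delta=(\mathrm{id}\otimes\Delta)\Delta$ such that the linear spans of $\Delta(A)(A\otimes 1)$ and $\Delta(A)(1\otimes A)$ are dense in $A\otimes A$. A finite-dimensional unitary representation of $\mathbb{G}$ on a finite-dimensional Hilbert space $H$ is a unitary $u\in\mathcal{B}(H)\otimes A$ with $(\mathrm{id}\otimes\Delta)(u)=u_{12}u_{13}$; $\mathrm{Mor}(u,v)=\{T\in\mathcal{B}(H_u,H_v) : (T\otimes 1)u=v(T\otimes 1)\}$; $u\otimes v=u_{13}v_{23}$; $u$ is irreducible if $H\neq 0$ and $\mathrm{Mor}(u,u)=\mathbb{C}1$. Let $\mathrm{Irred}(\mathbb{G})$ be the set of unitary equivalence classes of irreducible unitary representations (all of which are finite-dimensional), with a chosen representative $u^x$ on $H_x$ for each class $x$, and let $1$ be the class of the trivial representation. The dual discrete quantum group $\widehat{\mathbb{G}}$ has the von Neumann algebra $l^\infty(\widehat{\mathbb{G}})=\bigoplus^{\infty}_{x\in\mathrm{Irred}(\mathbb{G})}\mathcal{B}(H_x)$,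 with comultiplication $\hat\Delta$ determined by $\hat\Delta(a)S=Sa$ for $a\in\mathcal{B}(H_x)$, $S\in\mathrm{Mor}(u^x,u^y\otimes u^z)$. A unitary representation of $\widehat{\mathbb{G}}$ on a Hilbert space $K$ is a unitary $U=\sum_x U^x\in l^\infty(\widehat{\mathbb{G}})\otimes\mathcal{B}(K)$, $U^x\in\mathcal{B}(H_x)\otimes\mathcal{B}(K)$, with $(\hat\Delta\otimes\mathrm{id})(U)=U_{13}U_{23}$. A vector $\xi\in K$ is invariant if $U^x(\eta\otimes\xi)=\eta\otimes\xi$ for all $x\in\mathrm{Irred}(\mathbb{G})$ and $\eta\in H_x$. For $E\subset\mathrm{Irred}(\mathbb{G})$ and $\epsilon>0$, $U$ has an $(E,\epsilon)$-invariant vector if there is a unit vector $\xi\in K$ with $\|U^x(\eta\otimes\xi)-\eta\otimes\xi\|<\epsilon\|\eta\|$ for all $x\in E$ and all nonzero $\eta\in H_x$. $U$ has almost invariant vectors if it has an $(E,\epsilon)$-invariant vector for all finite $E$ and all $\epsilon>0$; $\widehat{\mathbb{G}}$ has property T if every unitary representation of $\widehat{\mathbb{G}}$ with almost invariant vectors has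 a nonzero invariant vector. A pair $(E,\epsilon)$ is a Kazhdan pair for $\widehat{\mathbb{G}}$ if $\epsilon>0$, $E\subset\mathrm{Irred}(\mathbb{G})$ is finite, $1\in E$, $E$ generates the finite-dimensional unitary representations of $\mathbb{G}$ (for each such representation $r$ there are finitely many $b_k\in\mathrm{Mor}(r_k,r)$, with $r_k$ a tensor product of representations $u^x$, $x\in E$, such that $\sum_k b_kb_k^*=1$), and every unitary representation of $\widehat{\mathbb{G}}$ with an $(E,\epsilon)$-invariant vector has a nonzero invariant vector. **Proposition 10.** If $\widehat{\mathbb{G}}$ is finite-dimensional, i.e. $\dim l^\infty(\widehat{\mathbb{G}})<\infty$, then $(\mathrm{Irred}(\mathbb{G}),\sqrt{2})$ is a Kazhdan pair for $\widehat{\mathbb{G}}$. In particular, $\widehat{\mathbb{G}}$ has property T. -/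

import Mathlib

open scoped TensorProduct Kronecker ENNReal

universe u v

noncomputable section

/-! ### Spatial tensor products -/

/-- The Hilbert space tensor product: the completion of the algebraic tensor product for
`⟪x ⊗ y, x' ⊗ y'⟫ = ⟪x, x'⟫ * ⟪y, y'⟫`. -/
def HilbertTensor (H K : Type*) [NormedAddCommGroup H] [InnerProductSpace ℂ H]
    [NormedAddCommGroup K] [InnerProductSpace ℂ K] : Type _ :=
  UniformSpace.Completion (H ⊗[ℂ] K)

section HilbertTensorInstances

variable (H K : Type*) [NormedAddCommGroup H] [InnerProductSpace ℂ H]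
  [NormedAddCommGroup K] [InnerProductSpace ℂ K]

instance : NormedAddCommGroup (HilbertTensor H K) :=
  inferInstanceAs (NormedAddCommGroup (UniformSpace.Completion (H ⊗[ℂ] K)))

instance : InnerProductSpace ℂ (HilbertTensor H K) :=
  inferInstanceAs (InnerProductSpace ℂ (UniformSpace.Completion (H ⊗[ℂ] K)))

instance : CompleteSpace (HilbertTensor H K) :=
  inferInstanceAs (CompleteSpace (UniformSpace.Completion (H ⊗[ℂ] K)))

variable {H K}

/-- The inclusion of the algebraic tensor product. -/
def HilbertTensor.of (x : H ⊗[ℂ] K) : HilbertTensor H K :=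
  (x : UniformSpace.Completion (H ⊗[ℂ] K))

theorem HilbertTensor.ext_of {X : Type*} [TopologicalSpace X] [T2Space X]
    {f g : HilbertTensor H K → X} (hf : Continuous f) (hg : Continuous g)
    (h : ∀ x, f (of x) = g (of x)) (x : HilbertTensor H K) : f x = g x :=
  UniformSpace.Completion.induction_on x (isClosed_eq hf hg) h

end HilbertTensorInstances

section Spatial

variable {H K : Type*} [NormedAddCommGroup H] [InnerProductSpace ℂ H]
  [NormedAddCommGroup K] [InnerProductSpace ℂ K]

/-- The bounded operator `S ⊗ T` on the Hilbert space tensor product. -/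
def opTensor (S : H →L[ℂ] H) (T : K →L[ℂ] K) : HilbertTensor H K →L[ℂ] HilbertTensor H K :=
  (TensorProduct.mapL S T).completion

theorem opTensor_of (S : H →L[ℂ] H) (T : K →L[ℂ] K) (x : H ⊗[ℂ] K) :
    opTensor S T (HilbertTensor.of x) = HilbertTensor.of (TensorProduct.mapL S T x) :=
  ContinuousLinearMap.completion_apply_coe _ _

theorem opTensor_mul (S S' : H →L[ℂ] H) (T T' : K →L[ℂ] K) :
    opTensor S T * opTensor S' T' = opTensor (S * S') (T * T') := by
  apply ContinuousLinearMap.ext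
  apply HilbertTensor.ext_of (ContinuousLinearMap.continuous _) (ContinuousLinearMap.continuous _)
  intro x
  simp only [mul_apply_eq_comp, opTensor_of, TensorProduct.mapL_mul]

theorem opTensor_one : opTensor (1 : H →L[ℂ] H) (1 : K →L[ℂ] K) = 1 := by
  apply ContinuousLinearMap.ext
  apply HilbertTensor.ext_of (ContinuousLinearMap.continuous _) (ContinuousLinearMap.continuous _)
  intro x
  rw [opTensor_of]
  congr 1
  exact congrArg (fun f => f x) (TensorProduct.mapL_id_id (𝕜 := ℂ) (E := H) (G := K))

variable [CompleteSpace H] [CompleteSpace K]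

variable {A B : Type*} [Ring A] [StarRing A] [Algebra ℂ A] [Ring B] [StarRing B] [Algebra ℂ B]

/-- The spatial (minimal) C*-tensor product of two *-algebras represented by `π` on `H` and by
`σ` on `K`: the norm closed *-subalgebra of `B(H ⊗ K)` generated by the operators
`π a ⊗ σ b`. For C*-algebras and faithful `π`, `σ` it is, up to canonical isomorphism, independent
of `π` and `σ`. -/
def spatialTensor (π : A →⋆ₐ[ℂ] (H →L[ℂ] H)) (σ : B →⋆ₐ[ℂ] (K →L[ℂ] K)) :
    StarSubalgebra ℂ (HilbertTensor H K →L[ℂ] HilbertTensor H K) :=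
  (StarAlgebra.adjoin ℂ
    (Set.range fun p : A × B => opTensor (π p.1) (σ p.2))).topologicalClosure

/-- The elementary tensor `a ⊗ b` as an element of the spatial tensor product. -/
def spatialTmul (π : A →⋆ₐ[ℂ] (H →L[ℂ] H)) (σ : B →⋆ₐ[ℂ] (K →L[ℂ] K)) (a : A) (b : B) :
    spatialTensor π σ :=
  ⟨opTensor (π a) (σ b), StarSubalgebra.le_topologicalClosure _
    (StarAlgebra.subset_adjoin ℂ _ ⟨(a, b), rfl⟩)⟩

theorem spatialTmul_mul (π : A →⋆ₐ[ℂ] (H →L[ℂ] H)) (σ : B →⋆ₐ[ℂ] (K →L[ℂ] K)) (a a' : A)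
    (b b' : B) :
    spatialTmul π σ a b * spatialTmul π σ a' b' = spatialTmul π σ (a * a') (b * b') := by
  apply Subtype.ext
  simp [spatialTmul, opTensor_mul]

theorem spatialTmul_one (π : A →⋆ₐ[ℂ] (H →L[ℂ] H)) (σ : B →⋆ₐ[ℂ] (K →L[ℂ] K)) :
    spatialTmul π σ 1 1 = 1 := by
  apply Subtype.ext
  simp [spatialTmul, opTensor_one]

end Spatial

/-! ### Compact quantum groups -/

/-- A compact quantum group `(A, Δ)`: a (nonzero) unital C*-algebra `A`, with a unital
*-homomorphism `Δ : A → A ⊗ A` into the minimal tensor product which is coassociative and satisfies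
the density conditions. A faithful representation `π` is carried along to realize `A ⊗ A`
spatially. -/
structure CompactQuantumGroup where
  A : Type u
  [cstarAlgebra : CStarAlgebra A]
  [nontrivial : Nontrivial A]
  H : Type u
  [normedAddCommGroup : NormedAddCommGroup H]
  [innerProductSpace : InnerProductSpace ℂ H]
  [completeSpace : CompleteSpace H]
  π : A →⋆ₐ[ℂ] (H →L[ℂ] H)
  π_injective : Function.Injective π
  Δ : A →⋆ₐ[ℂ] spatialTensor π π
  /-- `(Δ ⊗ id) Δ = (id ⊗ Δ) Δ`. The maps `Δ ⊗ id`, `id ⊗ Δ` and the identification `α` of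
  `(A ⊗ A) ⊗ A` with `A ⊗ (A ⊗ A)` are the *-homomorphisms (which always exist, and are unique
  by continuity) with the displayed values on elementary tensors. -/
  coassoc : ∃ (Δid : spatialTensor π π →⋆ₐ[ℂ] spatialTensor (spatialTensor π π).subtype π)
      (idΔ : spatialTensor π π →⋆ₐ[ℂ] spatialTensor π (spatialTensor π π).subtype)
      (α : spatialTensor (spatialTensor π π).subtype π ≃⋆ₐ[ℂ]
        spatialTensor π (spatialTensor π π).subtype),
    (∀ a b, Δid (spatialTmul π π a b) = spatialTmul _ π (Δ a) b) ∧
    (∀ a b, idΔ (spatialTmul π π a b) = spatialTmul π _ a (Δ b)) ∧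
    (∀ a b c, α (spatialTmul _ π (spatialTmul π π a b) c) =
      spatialTmul π _ a (spatialTmul π π b c)) ∧
    ∀ a, α (Δid (Δ a)) = idΔ (Δ a)
  /-- `Δ(A)(A ⊗ 1)` is dense in `A ⊗ A`. -/
  dense_left : Dense (Submodule.span ℂ
    (Set.range fun p : A × A => Δ p.1 * spatialTmul π π p.2 1) : Set (spatialTensor π π))
  /-- `Δ(A)(1 ⊗ A)` is dense in `A ⊗ A`. -/
  dense_right : Dense (Submodule.span ℂ
    (Set.range fun p : A × A => Δ p.1 * spatialTmul π π 1 p.2) : Set (spatialTensor π π))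

namespace CompactQuantumGroup

attribute [instance] cstarAlgebra nontrivial normedAddCommGroup innerProductSpace completeSpace

variable (G : CompactQuantumGroup.{u})

/-- The elementary tensor `a ⊗ b` in `A ⊗ A`. -/
abbrev tmul (a b : G.A) : spatialTensor G.π G.π := spatialTmul G.π G.π a b

/-! ### Finite-dimensional unitary representations of a compact quantum group -/

/-- A finite-dimensional unitary representation: a unitary `u = ∑ e_ij ⊗ u_ij` in
`B(ℂ^ι) ⊗ A = M_ι(A)` with `(id ⊗ Δ)(u) = u₁₂ u₁₃`. -/
structure FinRep where
  ι : Type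
  [fintype : Fintype ι]
  [decidableEq : DecidableEq ι]
  u : Matrix ι ι G.A
  mem_unitary : u ∈ unitary (Matrix ι ι G.A)
  comul : ∀ i j, G.Δ (u i j) = ∑ k, G.tmul (u i k) (u k j)

attribute [instance] FinRep.fintype FinRep.decidableEq

variable {G}

/-- The intertwiners `T ∈ B(H_r, H_s)`, `(T ⊗ 1) r = s (T ⊗ 1)`. -/
def Mor (r s : G.FinRep) : Set (Matrix s.ι r.ι ℂ) :=
  {T | T.map (algebraMap ℂ G.A) * r.u = s.u * T.map (algebraMap ℂ G.A)}

/-- A representation on a nonzero space is irreducible if `Mor r r = ℂ 1`. -/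
def FinRep.IsIrreducible (r : G.FinRep) : Prop :=
  Nonempty r.ι ∧ Mor r r = {T | ∃ c : ℂ, T = c • (1 : Matrix r.ι r.ι ℂ)}

/-- Unitary equivalence: there is a unitary intertwiner. -/
def FinRep.Equivalent (r s : G.FinRep) : Prop :=
  ∃ T ∈ Mor r s, T.conjTranspose * T = 1 ∧ T * T.conjTranspose = 1

/-- The trivial representation. -/
def FinRep.trivial (G : CompactQuantumGroup.{u}) : G.FinRep where
  ι := Unit
  u := 1
  mem_unitary := one_mem _
  comul := fun i j => by
    simp [tmul, spatialTmul_one]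

theorem kronecker_one_mul_apply {R : Type*} [Semiring R] {m n : Type*} [Fintype m] [Fintype n]
    [DecidableEq m] [DecidableEq n] (M : Matrix m m R) (N : Matrix n n R) (p q : m × n) :
    ((M ⊗ₖ (1 : Matrix n n R)) * ((1 : Matrix m m R) ⊗ₖ N)) p q = M p.1 q.1 * N p.2 q.2 := by
  simp [Matrix.mul_apply, Fintype.sum_prod_type, Matrix.one_apply, Matrix.kroneckerMap_apply]

theorem kronecker_one_mul_mem_unitary {R : Type*} [Ring R] [StarRing R] {m n : Type*}
    [Fintype m] [Fintype n] [DecidableEq m] [DecidableEq n] {M : Matrix m m R} {N : Matrix n n R}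
    (hM : M ∈ unitary (Matrix m m R)) (hN : N ∈ unitary (Matrix n n R)) :
    (M ⊗ₖ (1 : Matrix n n R)) * ((1 : Matrix m m R) ⊗ₖ N) ∈
      unitary (Matrix (m × n) (m × n) R) := by
  have h1 : ∀ A B : Matrix m m R, (A ⊗ₖ (1 : Matrix n n R)) * (B ⊗ₖ (1 : Matrix n n R)) =
      (A * B) ⊗ₖ (1 : Matrix n n R) := by
    intro A B
    ext p q
    by_cases h : p.2 = q.2 <;>
      simp [Matrix.mul_apply, Fintype.sum_prod_type, Matrix.one_apply, Matrix.kroneckerMap_apply, h]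
  have h2 : ∀ A B : Matrix n n R, ((1 : Matrix m m R) ⊗ₖ A) * ((1 : Matrix m m R) ⊗ₖ B) =
      (1 : Matrix m m R) ⊗ₖ (A * B) := by
    intro A B
    ext p q
    by_cases h : p.1 = q.1 <;>
      simp [Matrix.mul_apply, Fintype.sum_prod_type, Matrix.one_apply, Matrix.kroneckerMap_apply, h]
  have s1 : star (M ⊗ₖ (1 : Matrix n n R)) = star M ⊗ₖ (1 : Matrix n n R) := by
    ext p q
    by_cases h : p.2 = q.2 <;>
      simp [Matrix.one_apply, Matrix.kroneckerMap_apply, Matrix.star_apply, h, eq_comm]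
  have s2 : star ((1 : Matrix m m R) ⊗ₖ N) = (1 : Matrix m m R) ⊗ₖ star N := by
    ext p q
    by_cases h : p.1 = q.1 <;>
      simp [Matrix.one_apply, Matrix.kroneckerMap_apply, Matrix.star_apply, h, eq_comm]
  have e : (1 : Matrix m m R) ⊗ₖ (1 : Matrix n n R) = 1 := by
    ext p q
    simp only [Matrix.kroneckerMap_apply, Matrix.one_apply, Prod.ext_iff]
    by_cases h : p.1 = q.1 <;> by_cases h' : p.2 = q.2 <;> simp [h, h']
  rw [Unitary.mem_iff] at hM hN
  refine mul_mem ?_ ?_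
  · rw [Unitary.mem_iff, s1, h1, h1, hM.1, hM.2, e]
    exact ⟨rfl, rfl⟩
  · rw [Unitary.mem_iff, s2, h2, h2, hN.1, hN.2, e]
    exact ⟨rfl, rfl⟩

/-- The tensor product `u₁₃ v₂₃`. -/
def FinRep.tensor (r s : G.FinRep) : G.FinRep where
  ι := r.ι × s.ι
  u := (r.u ⊗ₖ (1 : Matrix s.ι s.ι G.A)) * ((1 : Matrix r.ι r.ι G.A) ⊗ₖ s.u)
  mem_unitary := kronecker_one_mul_mem_unitary r.mem_unitary s.mem_unitary
  comul := fun p q => by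
    simp only [kronecker_one_mul_apply, map_mul, r.comul, s.comul, tmul, Finset.sum_mul_sum,
      spatialTmul_mul, Fintype.sum_prod_type]

theorem FinRep.trivial_isIrreducible (G : CompactQuantumGroup.{u}) :
    (FinRep.trivial G).IsIrreducible := by
  refine ⟨⟨()⟩, Set.ext fun T => ⟨fun _ => ⟨T () (), ?_⟩, fun _ => ?_⟩⟩
  · ext i j
    change T () () = (T () () • (1 : Matrix Unit Unit ℂ)) () ()
    simp
  · exact (Matrix.mul_one _).trans (Matrix.one_mul _).symm

theorem FinRep.equivalent_refl (r : G.FinRep) : r.Equivalent r :=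
  ⟨1, by simp [Mor], by simp, by simp⟩

theorem map_algebraMap_mul {l m n : Type} [Fintype m] (S : Matrix l m ℂ) (T : Matrix m n ℂ) :
    (S * T).map (algebraMap ℂ G.A) =
      S.map (algebraMap ℂ G.A) * T.map (algebraMap ℂ G.A) :=
  Matrix.map_mul

theorem FinRep.Equivalent.symm {r s : G.FinRep} (h : r.Equivalent s) : s.Equivalent r := by
  obtain ⟨T, hT, h1, h2⟩ := h
  refine ⟨T.conjTranspose, ?_, by simpa using h2, by simpa using h1⟩
  have e1 := map_algebraMap_mul (G := G) T.conjTranspose T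
  have e2 := map_algebraMap_mul (G := G) T T.conjTranspose
  rw [h1, Matrix.map_one _ (map_zero _) (map_one _)] at e1
  rw [h2, Matrix.map_one _ (map_zero _) (map_one _)] at e2
  simp only [Mor, Set.mem_ofPred_eq] at hT ⊢
  calc T.conjTranspose.map (algebraMap ℂ G.A) * s.u
      = T.conjTranspose.map (algebraMap ℂ G.A) * (s.u * T.map (algebraMap ℂ G.A)) *
          T.conjTranspose.map (algebraMap ℂ G.A) := by
        rw [Matrix.mul_assoc, Matrix.mul_assoc, ← e2, Matrix.mul_one]
    _ = r.u * T.conjTranspose.map (algebraMap ℂ G.A) := by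
        rw [← hT, ← Matrix.mul_assoc, ← e1, Matrix.one_mul]

theorem FinRep.Equivalent.trans {r s t : G.FinRep} (h : r.Equivalent s) (h' : s.Equivalent t) :
    r.Equivalent t := by
  obtain ⟨S, hS, h1, h2⟩ := h
  obtain ⟨T, hT, h3, h4⟩ := h'
  refine ⟨T * S, ?_, ?_, ?_⟩
  · simp only [Mor, Set.mem_ofPred_eq] at hS hT ⊢
    rw [map_algebraMap_mul, Matrix.mul_assoc, hS, ← Matrix.mul_assoc, hT, Matrix.mul_assoc]
  · rw [Matrix.conjTranspose_mul, Matrix.mul_assoc, ← Matrix.mul_assoc _ T, h3, Matrix.one_mul, h1]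
  · rw [Matrix.conjTranspose_mul, Matrix.mul_assoc, ← Matrix.mul_assoc S, h2, Matrix.one_mul, h4]

/-- Unitary equivalence on the irreducible representations. -/
instance irredSetoid (G : CompactQuantumGroup.{u}) : Setoid {r : G.FinRep // r.IsIrreducible} where
  r a b := a.1.Equivalent b.1
  iseqv := ⟨fun a => a.1.equivalent_refl, fun h => h.symm, fun h h' => h.trans h'⟩

/-- `Irred(G)`: the equivalence classes of irreducible unitary representations. -/
def Irred (G : CompactQuantumGroup.{u}) : Type (max u 1) := Quotient (irredSetoid G)

/-- The class of the trivial representation. -/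
def Irred.one (G : CompactQuantumGroup.{u}) : Irred G :=
  Quotient.mk _ ⟨FinRep.trivial G, FinRep.trivial_isIrreducible G⟩

/-- A chosen representative `u^x` of `x`. -/
def Irred.rep (x : Irred G) : G.FinRep := (Quotient.out x).1

/-- The Hilbert space `H_x` of the chosen representative. -/
abbrev Irred.space (x : Irred G) : Type := EuclideanSpace ℂ x.rep.ι

/-- The tensor product `u^{x₁} ⊗ ⋯ ⊗ u^{xₙ}`. -/
def Irred.prod : List (Irred G) → G.FinRep
  | [] => FinRep.trivial G
  | x :: l => FinRep.tensor x.rep (Irred.prod l)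

/-- The category of finite-dimensional unitary representations is generated by `E`: for every
finite-dimensional unitary representation `r` there are finitely many intertwiners
`b_k ∈ Mor(r_k, r)`, with `r_k` a product of elements of `E`, such that `∑ b_k b_k^* = 1`. -/
def IsGenerating (E : Set (Irred G)) : Prop :=
  ∀ r : G.FinRep, ∃ (n : ℕ) (w : Fin n → List (Irred G))
    (b : ∀ k, Matrix r.ι (Irred.prod (w k)).ι ℂ),
    (∀ k, ∀ x ∈ w k, x ∈ E) ∧ (∀ k, b k ∈ Mor (Irred.prod (w k)) r) ∧
    ∑ k, b k * (b k).conjTranspose = 1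

/-! ### The dual discrete quantum group -/

/-- The von Neumann algebra `l^∞(Ĝ)`: the bounded families in `∏ₓ B(H_x)`. -/
abbrev ellInfty (G : CompactQuantumGroup.{u}) : Type (max u 1) :=
  lp (fun x : Irred G => x.space →L[ℂ] x.space) ∞

/-- The dual discrete quantum group `Ĝ` is finite-dimensional. -/
def DualFiniteDimensional (G : CompactQuantumGroup.{u}) : Prop :=
  FiniteDimensional ℂ (ellInfty G)

section Dual

variable {K : Type v} [NormedAddCommGroup K] [InnerProductSpace ℂ K] [CompleteSpace K]

/-- `W = (Δ̂ ⊗ id)(U)` for `U = ∑ₓ U^x` in `l^∞(Ĝ) ⊗ B(K)` and `W = ∑ W^{y,z}` in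
`l^∞(Ĝ) ⊗ l^∞(Ĝ) ⊗ B(K)`, where `Δ̂` is the comultiplication of `Ĝ`, i.e.
`Δ̂(a) S = S a` for `a ∈ B(H_x)` and `S ∈ Mor(x, y ⊗ z)`. Here `B(H_x) ⊗ B(K)` is
`M_{n_x}(B(K))`. -/
def IsDualComul (U : ∀ x : Irred G, Matrix x.rep.ι x.rep.ι (K →L[ℂ] K))
    (W : ∀ y z : Irred G,
      Matrix (y.rep.ι × z.rep.ι) (y.rep.ι × z.rep.ι) (K →L[ℂ] K)) : Prop :=
  ∀ (x y z : Irred G) (S : Matrix (y.rep.ι × z.rep.ι) x.rep.ι ℂ),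
    S ∈ Mor x.rep (FinRep.tensor y.rep z.rep) →
      W y z * S.map (algebraMap ℂ (K →L[ℂ] K)) = S.map (algebraMap ℂ (K →L[ℂ] K)) * U x

variable (G K) in
/-- A unitary representation of `Ĝ` on `K`: a unitary `U = ∑ₓ U^x` in `l^∞(Ĝ) ⊗ B(K)`, i.e. a
family of unitaries `U^x ∈ B(H_x) ⊗ B(K)`, with `(Δ̂ ⊗ id)(U) = U₁₃ U₂₃`. -/
structure DualRep where
  U : ∀ x : Irred G, Matrix x.rep.ι x.rep.ι (K →L[ℂ] K)
  mem_unitary : ∀ x, U x ∈ unitary (Matrix x.rep.ι x.rep.ι (K →L[ℂ] K))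
  comul : IsDualComul U fun y z =>
    (U y ⊗ₖ (1 : Matrix z.rep.ι z.rep.ι (K →L[ℂ] K))) *
      ((1 : Matrix y.rep.ι y.rep.ι (K →L[ℂ] K)) ⊗ₖ U z)

/-- `η ⊗ ξ` in `ℂ^ι ⊗ K = K^ι` (Hilbert space direct sum). -/
def vecTensor {ι : Type} [Fintype ι] (η : EuclideanSpace ℂ ι) (ξ : K) :
    PiLp 2 (fun _ : ι => K) :=
  WithLp.toLp 2 fun i => η i • ξ

/-- The action of `M = ∑ e_ij ⊗ M_ij` on a vector of `ℂ^ι ⊗ K = K^ι`. -/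
def matAct {ι : Type} [Fintype ι] (M : Matrix ι ι (K →L[ℂ] K)) (v : PiLp 2 (fun _ : ι => K)) :
    PiLp 2 (fun _ : ι => K) :=
  WithLp.toLp 2 fun i => ∑ j, M i j (v j)

/-- `U` has an `(E, ε)`-invariant vector. -/
def DualRep.HasInvariantVectorUpTo (U : DualRep G K) (E : Set (Irred G)) (ε : ℝ) : Prop :=
  ∃ ξ : K, ‖ξ‖ = 1 ∧ ∀ x ∈ E, ∀ η : x.space, η ≠ 0 →
    ‖matAct (U.U x) (vecTensor η ξ) - vecTensor η ξ‖ < ε * ‖η‖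

/-- `U` has almost invariant vectors. -/
def DualRep.HasAlmostInvariantVectors (U : DualRep G K) : Prop :=
  ∀ E : Set (Irred G), E.Finite → ∀ ε : ℝ, 0 < ε → U.HasInvariantVectorUpTo E ε

/-- `U` has a nonzero invariant vector. -/
def DualRep.HasNonzeroInvariantVector (U : DualRep G K) : Prop :=
  ∃ ξ : K, ξ ≠ 0 ∧ ∀ (x : Irred G) (η : x.space),
    matAct (U.U x) (vecTensor η ξ) = vecTensor η ξ

end Dual

/-- Property T of the discrete quantum group `Ĝ`. -/
def HasPropertyT (G : CompactQuantumGroup.{u}) : Prop :=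
  ∀ (K : Type v) [NormedAddCommGroup K] [InnerProductSpace ℂ K] [CompleteSpace K]
    (U : DualRep G K), U.HasAlmostInvariantVectors → U.HasNonzeroInvariantVector

/-- `(E, ε)` is a Kazhdan pair for `Ĝ`: `E` is a finite generating subset of `Irred(G)` with
`1 ∈ E`, `ε > 0`, and every unitary representation of `Ĝ` with an `(E, ε)`-invariant vector has a
nonzero invariant vector. -/
structure IsKazhdanPair (G : CompactQuantumGroup.{u}) (E : Set (Irred G)) (ε : ℝ) : Prop where
  finite : E.Finite
  one_mem : Irred.one G ∈ E
  generating : IsGenerating E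
  pos : 0 < ε
  exists_invariant : ∀ (K : Type v) [NormedAddCommGroup K] [InnerProductSpace ℂ K]
    [CompleteSpace K] (U : DualRep G K),
    U.HasInvariantVectorUpTo E ε → U.HasNonzeroInvariantVector

end CompactQuantumGroup

end

/-! Let `ξ` be a unit `(Irred G, √2)`-invariant vector. For unit `η`, the squared displacement of `η
⊗ ξ` under `U^x` is `2 - 2 Re ⟪ξ, (ω_η ⊗ id)(U^x) ξ⟫` (`norm_matAct_sub_sq`), so `√2` is exactly the
threshold below which this real part is positive. Finite-dimensionality leaves finitely many classes
`x`, each with a compact unit sphere, so the real parts have a common bound `δ > 0`. The closed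
convex hull `C` of the vectors `(ω_η ⊗ id)(U^x) ξ` therefore lies in a half-space that excludes `0`.

The slices `(ω_η ⊗ id)(U^x)` map `C` into itself (`DualRep.vecSlice_mem_closedConvexHull`):
splitting `u^y ⊗ u^z` into irreducibles writes a product of two slices as a convex combination of
slices. They are also contractions (`norm_vecSlice_le`), so they fix the unique point of `C` of
least norm. That point is nonzero, and a vector fixed by all slices is invariant.

Generation by all of `Irred G` is complete reducibility, `FinRep.exists_irred_decomposition`, which
also supplies the splitting of `u^y ⊗ u^z`. -/

noncomputable section

/-! ### Bilinearity of elementary tensors and the two legs of `A ⊗ A` -/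

section SpatialLinear

variable {H K : Type*} [NormedAddCommGroup H] [InnerProductSpace ℂ H]
  [NormedAddCommGroup K] [InnerProductSpace ℂ K]

theorem HilbertTensor.of_add (x y : H ⊗[ℂ] K) : of (x + y) = of x + of y :=
  UniformSpace.Completion.coe_add x y

theorem HilbertTensor.of_smul (c : ℂ) (x : H ⊗[ℂ] K) : of (c • x) = c • of x :=
  UniformSpace.Completion.coe_smul c x

theorem opTensor_add_left (S S' : H →L[ℂ] H) (T : K →L[ℂ] K) :
    opTensor (S + S') T = opTensor S T + opTensor S' T := by
  apply ContinuousLinearMap.ext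
  apply HilbertTensor.ext_of (ContinuousLinearMap.continuous _) (ContinuousLinearMap.continuous _)
  intro x
  rw [add_apply, opTensor_of, opTensor_of, opTensor_of,
    ← HilbertTensor.of_add, TensorProduct.mapL_add_left, add_apply]

theorem opTensor_add_right (S : H →L[ℂ] H) (T T' : K →L[ℂ] K) :
    opTensor S (T + T') = opTensor S T + opTensor S T' := by
  apply ContinuousLinearMap.ext
  apply HilbertTensor.ext_of (ContinuousLinearMap.continuous _) (ContinuousLinearMap.continuous _)
  intro x
  rw [add_apply, opTensor_of, opTensor_of, opTensor_of,
    ← HilbertTensor.of_add, TensorProduct.mapL_add_right, add_apply]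

theorem opTensor_smul_left (c : ℂ) (S : H →L[ℂ] H) (T : K →L[ℂ] K) :
    opTensor (c • S) T = c • opTensor S T := by
  apply ContinuousLinearMap.ext
  apply HilbertTensor.ext_of (ContinuousLinearMap.continuous _) (ContinuousLinearMap.continuous _)
  intro x
  rw [smul_apply, opTensor_of, opTensor_of, ← HilbertTensor.of_smul,
    TensorProduct.mapL_smul_left, smul_apply]

theorem opTensor_smul_right (c : ℂ) (S : H →L[ℂ] H) (T : K →L[ℂ] K) :
    opTensor S (c • T) = c • opTensor S T := by
  apply ContinuousLinearMap.ext
  apply HilbertTensor.ext_of (ContinuousLinearMap.continuous _) (ContinuousLinearMap.continuous _)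
  intro x
  rw [smul_apply, opTensor_of, opTensor_of, ← HilbertTensor.of_smul,
    TensorProduct.mapL_smul_right, smul_apply]

variable [CompleteSpace H] [CompleteSpace K]

variable {A B : Type*} [Ring A] [StarRing A] [Algebra ℂ A] [Ring B] [StarRing B] [Algebra ℂ B]

/-- The embedding `a ↦ a ⊗ 1`. -/
def spatialInl (π : A →⋆ₐ[ℂ] (H →L[ℂ] H)) (σ : B →⋆ₐ[ℂ] (K →L[ℂ] K)) :
    A →ₐ[ℂ] spatialTensor π σ :=
  AlgHom.ofLinearMap
    { toFun := fun a => spatialTmul π σ a 1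
      map_add' := fun a b => Subtype.ext <| by simp [spatialTmul, opTensor_add_left]
      map_smul' := fun c a => Subtype.ext <| by simp [spatialTmul, opTensor_smul_left] }
    (spatialTmul_one π σ) fun a b => by
      simp only [LinearMap.coe_mk, AddHom.coe_mk, spatialTmul_mul, mul_one]

/-- The embedding `b ↦ 1 ⊗ b`. -/
def spatialInr (π : A →⋆ₐ[ℂ] (H →L[ℂ] H)) (σ : B →⋆ₐ[ℂ] (K →L[ℂ] K)) :
    B →ₐ[ℂ] spatialTensor π σ :=
  AlgHom.ofLinearMap
    { toFun := fun b => spatialTmul π σ 1 b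
      map_add' := fun a b => Subtype.ext <| by simp [spatialTmul, opTensor_add_right]
      map_smul' := fun c a => Subtype.ext <| by simp [spatialTmul, opTensor_smul_right] }
    (spatialTmul_one π σ) fun a b => by
      simp only [LinearMap.coe_mk, AddHom.coe_mk, spatialTmul_mul, mul_one]

theorem spatialInl_mul_spatialInr (π : A →⋆ₐ[ℂ] (H →L[ℂ] H)) (σ : B →⋆ₐ[ℂ] (K →L[ℂ] K))
    (a : A) (b : B) : spatialInl π σ a * spatialInr π σ b = spatialTmul π σ a b := by
  change spatialTmul π σ a 1 * spatialTmul π σ 1 b = _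
  rw [spatialTmul_mul, mul_one, one_mul]

end SpatialLinear

namespace Matrix

variable {R S : Type*} [Ring R] [Algebra ℂ R] [Ring S] [Algebra ℂ S] {m n : Type*}

theorem map_algebraMap_map_algHom (f : R →ₐ[ℂ] S) (T : Matrix m n ℂ) :
    (T.map (algebraMap ℂ R)).map f = T.map (algebraMap ℂ S) := by
  ext i j
  simp

theorem map_algebraMap_conjTranspose [StarRing R] [StarModule ℂ R] (T : Matrix m n ℂ) :
    (T.map (algebraMap ℂ R)).conjTranspose = T.conjTranspose.map (algebraMap ℂ R) := by
  ext i j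
  exact (algebraMap_star_comm (T j i)).symm

theorem map_algebraMap_one [DecidableEq m] :
    (1 : Matrix m m ℂ).map (algebraMap ℂ R) = 1 :=
  Matrix.map_one _ (map_zero _) (map_one _)

end Matrix

/-! ### Intertwiners and subrepresentations -/

namespace CompactQuantumGroup

open Matrix

variable {G : CompactQuantumGroup.{u}}

/-- With the legs as algebra homomorphisms, the coordinate rule becomes `u₁₂ u₁₃` as one matrix
identity, open to matrix algebra. -/
theorem FinRep.map_comul (r : G.FinRep) :
    r.u.map G.Δ = r.u.map (spatialInl G.π G.π) * r.u.map (spatialInr G.π G.π) := by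
  ext1 i j
  simp only [Matrix.map_apply, Matrix.mul_apply, spatialInl_mul_spatialInr, r.comul]

theorem FinRep.comul_of_map_eq {ι : Type} [Fintype ι] {u : Matrix ι ι G.A}
    (h : u.map G.Δ = u.map (spatialInl G.π G.π) * u.map (spatialInr G.π G.π)) (i j : ι) :
    G.Δ (u i j) = ∑ k, G.tmul (u i k) (u k j) := by
  have := congrFun (congrFun h i) j
  simpa only [Matrix.map_apply, Matrix.mul_apply, spatialInl_mul_spatialInr] using this

theorem mem_mor_iff {r s : G.FinRep} {T : Matrix s.ι r.ι ℂ} :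
    T ∈ Mor r s ↔ T.map (algebraMap ℂ G.A) * r.u = s.u * T.map (algebraMap ℂ G.A) :=
  Iff.rfl

theorem mul_mem_mor {r s t : G.FinRep} {S : Matrix t.ι s.ι ℂ} {T : Matrix s.ι r.ι ℂ}
    (hS : S ∈ Mor s t) (hT : T ∈ Mor r s) : S * T ∈ Mor r t := by
  rw [mem_mor_iff] at *
  rw [map_algebraMap_mul, Matrix.mul_assoc, hT, ← Matrix.mul_assoc, hS, Matrix.mul_assoc]

theorem add_mem_mor {r s : G.FinRep} {S T : Matrix s.ι r.ι ℂ}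
    (hS : S ∈ Mor r s) (hT : T ∈ Mor r s) : S + T ∈ Mor r s := by
  rw [mem_mor_iff] at *
  rw [Matrix.map_add _ (map_add _), Matrix.add_mul, Matrix.mul_add, hS, hT]

theorem smul_mem_mor {r s : G.FinRep} {T : Matrix s.ι r.ι ℂ} (c : ℂ)
    (hT : T ∈ Mor r s) : c • T ∈ Mor r s := by
  have e : (c • T).map (algebraMap ℂ G.A) = c • T.map (algebraMap ℂ G.A) := by
    ext i j
    simp [Algebra.smul_def]
  rw [mem_mor_iff] at *
  rw [e, Matrix.smul_mul, Matrix.mul_smul, hT]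

theorem FinRep.star_mul_self (r : G.FinRep) : r.uᴴ * r.u = 1 :=
  (Unitary.mem_iff.1 r.mem_unitary).1

theorem FinRep.mul_star_self (r : G.FinRep) : r.u * r.uᴴ = 1 :=
  (Unitary.mem_iff.1 r.mem_unitary).2

/-- Take adjoints in the intertwining relation, then cancel `rᴴ` and `sᴴ` by unitarity. -/
theorem conjTranspose_mem_mor {r s : G.FinRep} {T : Matrix s.ι r.ι ℂ} (hT : T ∈ Mor r s) :
    Tᴴ ∈ Mor s r := by
  rw [mem_mor_iff] at *
  have h := congrArg conjTranspose hT
  rw [conjTranspose_mul, conjTranspose_mul, map_algebraMap_conjTranspose] at h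
  calc Tᴴ.map (algebraMap ℂ G.A) * s.u
      = r.u * (r.uᴴ * Tᴴ.map (algebraMap ℂ G.A)) * s.u := by
        rw [← Matrix.mul_assoc, r.mul_star_self, Matrix.one_mul]
    _ = r.u * Tᴴ.map (algebraMap ℂ G.A) := by
        rw [h, Matrix.mul_assoc, Matrix.mul_assoc, s.star_mul_self, Matrix.mul_one]

theorem smul_one_mem_mor (r : G.FinRep) (c : ℂ) : c • (1 : Matrix r.ι r.ι ℂ) ∈ Mor r r :=
  smul_mem_mor c <| by rw [mem_mor_iff, map_algebraMap_one, Matrix.one_mul, Matrix.mul_one]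

/-- The restriction of a representation to the range of an isometry `V` whose range projection is
an intertwiner. -/
def FinRep.compress (r : G.FinRep) {ι : Type} [Fintype ι] [DecidableEq ι] (V : Matrix r.ι ι ℂ)
    (hV : Vᴴ * V = 1) (hp : V * Vᴴ ∈ Mor r r) : G.FinRep :=
  let W := V.map (algebraMap ℂ G.A)
  have hW : Wᴴ * W = 1 := by
    rw [map_algebraMap_conjTranspose, ← map_algebraMap_mul, hV, map_algebraMap_one]
  have hq : W * Wᴴ * r.u = r.u * (W * Wᴴ) := by
    rw [map_algebraMap_conjTranspose, ← map_algebraMap_mul]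
    exact hp
  { ι := ι
    u := Wᴴ * r.u * W
    mem_unitary := by
      have hq' : W * Wᴴ * r.uᴴ = r.uᴴ * (W * Wᴴ) := by
        have := congrArg conjTranspose hq
        simpa [Matrix.mul_assoc] using this.symm
      rw [Unitary.mem_iff, star_eq_conjTranspose]
      constructor
      · calc (Wᴴ * r.u * W)ᴴ * (Wᴴ * r.u * W) = Wᴴ * (r.uᴴ * (W * Wᴴ)) * r.u * W := by
              simp [Matrix.mul_assoc]
          _ = (Wᴴ * W) * Wᴴ * (r.uᴴ * r.u) * W := by
              rw [← hq']
              simp only [Matrix.mul_assoc]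
          _ = 1 := by rw [hW, r.star_mul_self, Matrix.one_mul, Matrix.mul_one, hW]
      · calc (Wᴴ * r.u * W) * (Wᴴ * r.u * W)ᴴ = Wᴴ * (r.u * (W * Wᴴ)) * r.uᴴ * W := by
              simp [Matrix.mul_assoc]
          _ = (Wᴴ * W) * Wᴴ * (r.u * r.uᴴ) * W := by
              rw [← hq]
              simp only [Matrix.mul_assoc]
          _ = 1 := by rw [hW, r.mul_star_self, Matrix.one_mul, Matrix.mul_one, hW]
    comul := by
      apply FinRep.comul_of_map_eq
      have hΔ : ∀ M : Matrix ι ι G.A, M.map G.Δ = M.map (G.Δ : G.A →ₐ[ℂ] _) := fun _ => rfl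
      have hΔ' : r.u.map (G.Δ : G.A →ₐ[ℂ] spatialTensor G.π G.π) = _ := r.map_comul
      have hl := congrArg (fun M => M.map (spatialInl G.π G.π)) hq
      have hl' := congrArg (fun M => M.map (spatialInl G.π G.π)) hW
      have hW' : Wᴴ = Vᴴ.map (algebraMap ℂ G.A) := map_algebraMap_conjTranspose V
      rw [hΔ]
      simp only [hW', W, Matrix.map_mul, map_algebraMap_map_algHom] at hl hl' ⊢
      rw [Matrix.map_one _ (map_zero _) (map_one _)] at hl'
      rw [hΔ']
      set C := V.map (algebraMap ℂ (spatialTensor G.π G.π))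
      set C' := Vᴴ.map (algebraMap ℂ (spatialTensor G.π G.π))
      set L := r.u.map (spatialInl G.π G.π)
      set R := r.u.map (spatialInr G.π G.π)
      -- Insert `C' * C = 1`, then commute the projection `C * C'` past `L`; this puts it between
      -- the two legs.
      calc C' * (L * R) * C = (C' * C) * C' * L * R * C := by
            rw [hl', Matrix.one_mul]
            simp only [Matrix.mul_assoc]
        _ = C' * (C * C' * L) * R * C := by simp only [Matrix.mul_assoc]
        _ = C' * L * C * (C' * R * C) := by
            rw [hl]
            simp only [Matrix.mul_assoc] }

theorem FinRep.mem_mor_compress (r : G.FinRep) {ι : Type} [Fintype ι] [DecidableEq ι]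
    (V : Matrix r.ι ι ℂ) (hV : Vᴴ * V = 1) (hp : V * Vᴴ ∈ Mor r r) :
    V ∈ Mor (r.compress V hV hp) r := by
  rw [mem_mor_iff] at *
  set W := V.map (algebraMap ℂ G.A)
  have hW : Wᴴ * W = 1 := by
    rw [map_algebraMap_conjTranspose, ← map_algebraMap_mul, hV, map_algebraMap_one]
  have hq : W * Wᴴ * r.u = r.u * (W * Wᴴ) := by
    rw [map_algebraMap_conjTranspose, ← map_algebraMap_mul]
    exact hp
  change W * (Wᴴ * r.u * W) = r.u * W
  calc W * (Wᴴ * r.u * W) = W * Wᴴ * r.u * W := by simp only [Matrix.mul_assoc]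
    _ = r.u * (W * (Wᴴ * W)) := by rw [hq]; simp only [Matrix.mul_assoc]
    _ = r.u * W := by rw [hW, Matrix.mul_one]

end CompactQuantumGroup

/-! ### Finitely many blocks in a finite-dimensional `l^∞` sum -/

/-- One nonzero vector from each summand gives a linearly independent family indexed by `ι`. -/
theorem lp.finite_of_finiteDimensional {ι : Type*} {E : ι → Type*} [∀ i, NormedAddCommGroup (E i)]
    [∀ i, NormedSpace ℂ (E i)] [∀ i, Nontrivial (E i)] {p : ℝ≥0∞}
    (h : FiniteDimensional ℂ (lp E p)) : Finite ι := by
  classical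
  choose a ha using fun i => exists_ne (0 : E i)
  refine LinearIndependent.finite (R := ℂ) (f := fun i => lp.single p i (a i)) ?_
  rw [linearIndependent_iff']
  intro s g hg i hi
  have h := congrFun (congrArg Subtype.val hg) i
  rw [lp.coeFn_sum, Finset.sum_apply, Finset.sum_eq_single i] at h
  · have h' : g i • a i = 0 := by simpa using h
    exact (smul_eq_zero.1 h').resolve_right (ha i)
  · intro j _ hj
    simp [Ne.symm hj]
  · exact fun hi' => absurd hi hi'

/-! ### Complete reducibility and generation -/

namespace CompactQuantumGroup

open Matrix

variable {G : CompactQuantumGroup.{u}}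

/-- Entrywise, commutation says `(d i - d j) • u i j = 0`, so `u i j` vanishes unless `d i = d j`.
This plays the role of functional calculus and yields spectral projections as intertwiners. -/
theorem diagonal_mem_mor_of_diagonal_mem_mor {r : G.FinRep} {d f : r.ι → ℂ}
    (hd : diagonal d ∈ Mor r r) (hf : ∀ i j, d i = d j → f i = f j) :
    diagonal f ∈ Mor r r := by
  rw [mem_mor_iff, diagonal_map (map_zero _)] at *
  ext i j
  have h := congrFun (congrFun hd i) j
  simp only [diagonal_mul, mul_diagonal] at h ⊢
  rw [← Algebra.commutes, ← sub_eq_zero, ← sub_mul, ← map_sub, ← Algebra.smul_def,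
    smul_eq_zero, sub_eq_zero] at h
  rcases h with h | h
  · rw [hf i j h, Algebra.commutes]
  · rw [h, mul_zero, zero_mul]

/-- If the Hermitian combinations `T + Tᴴ` and `i(T - Tᴴ)` were both scalar, `T` would be too. -/
theorem FinRep.exists_isHermitian_mem_mor {r : G.FinRep} {T : Matrix r.ι r.ι ℂ}
    (hT : T ∈ Mor r r) (hT' : ∀ c : ℂ, T ≠ c • (1 : Matrix r.ι r.ι ℂ)) :
    ∃ a ∈ Mor r r, a.IsHermitian ∧ ∀ c : ℂ, a ≠ c • (1 : Matrix r.ι r.ι ℂ) := by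
  have hs := conjTranspose_mem_mor hT
  by_contra! H
  obtain ⟨c, hc⟩ := H (T + Tᴴ) (add_mem_mor hT hs) (isHermitian_add_transpose_self T)
  obtain ⟨e, he⟩ := H (Complex.I • (T + (-1 : ℂ) • Tᴴ))
    (smul_mem_mor _ (add_mem_mor hT (smul_mem_mor _ hs))) <| by
      rw [IsHermitian, conjTranspose_smul, conjTranspose_add, conjTranspose_smul,
        conjTranspose_conjTranspose]
      simp [add_comm]
  refine hT' ((1 / 2 : ℂ) * (c - Complex.I * e)) ?_
  have h2 : (2 : ℂ) • T = (T + Tᴴ) - Complex.I • (Complex.I • (T + (-1 : ℂ) • Tᴴ)) := by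
    rw [smul_smul, Complex.I_mul_I]
    module
  rw [mul_smul, sub_smul, mul_smul, ← hc, ← he, ← h2, smul_smul]
  norm_num

/-- A representation with a non-scalar self-intertwiner is the direct sum of two representations
of smaller dimension. -/
theorem FinRep.exists_decomposition (r : G.FinRep) {T : Matrix r.ι r.ι ℂ}
    (hT : T ∈ Mor r r) (hT' : ∀ c : ℂ, T ≠ c • (1 : Matrix r.ι r.ι ℂ)) :
    ∃ (s t : G.FinRep) (V : Matrix r.ι s.ι ℂ) (W : Matrix r.ι t.ι ℂ), V ∈ Mor s r ∧ W ∈ Mor t r ∧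
      Fintype.card s.ι < Fintype.card r.ι ∧ Fintype.card t.ι < Fintype.card r.ι ∧
      V * Vᴴ + W * Wᴴ = 1 := by
  obtain ⟨a, ha, hherm, hne⟩ := FinRep.exists_isHermitian_mem_mor hT hT'
  set X : Matrix r.ι r.ι ℂ := (hherm.eigenvectorUnitary : Matrix r.ι r.ι ℂ)
  set d : r.ι → ℂ := RCLike.ofReal ∘ hherm.eigenvalues
  have hXX : Xᴴ * X = 1 := (Unitary.mem_iff.1 hherm.eigenvectorUnitary.2).1
  have hXX' : X * Xᴴ = 1 := (Unitary.mem_iff.1 hherm.eigenvectorUnitary.2).2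
  have hspec : a = X * diagonal d * Xᴴ := by
    have := hherm.spectral_theorem
    rwa [Unitary.conjStarAlgAut_apply] at this
  -- Compressing by the unitary `X` is just a change of basis, to one where `a` is diagonal.
  have h1 : X * Xᴴ ∈ Mor r r := by
    rw [hXX']
    simpa using smul_one_mem_mor r 1
  have hXm := r.mem_mor_compress X hXX h1
  have hXm' := conjTranspose_mem_mor hXm
  have hD : diagonal d ∈ Mor (r.compress X hXX h1) (r.compress X hXX h1) := by
    have h := mul_mem_mor hXm' (mul_mem_mor ha hXm)
    have e : Xᴴ * (a * X) = diagonal d := by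
      rw [hspec]
      calc Xᴴ * (X * diagonal d * Xᴴ * X) = (Xᴴ * X) * diagonal d * (Xᴴ * X) := by
            simp only [Matrix.mul_assoc]
        _ = diagonal d := by rw [hXX, Matrix.one_mul, Matrix.mul_one]
    exact e ▸ h
  -- A union of eigenspaces of `a` carries a subrepresentation: the eigenvectors selected by `P` are
  -- the columns of an isometry whose range projection is an intertwiner.
  have block : ∀ (P : r.ι → Prop) [DecidablePred P], (∀ i j, d i = d j → (P i ↔ P j)) →
      ∃ (s : G.FinRep) (V : Matrix r.ι s.ι ℂ), V ∈ Mor s r ∧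
        Fintype.card s.ι = Fintype.card {i // P i} ∧
        V * Vᴴ = X * diagonal (fun i => if P i then 1 else 0) * Xᴴ := by
    intro P _ hP
    have hf : ∀ i j, d i = d j → (if P i then (1 : ℂ) else 0) = if P j then 1 else 0 :=
      fun i j h => if_congr (hP i j h) rfl rfl
    have hE : diagonal (fun i => if P i then (1 : ℂ) else 0) ∈
        Mor (r.compress X hXX h1) (r.compress X hXX h1) :=
      diagonal_mem_mor_of_diagonal_mem_mor (r := r.compress X hXX h1) (d := d) hD hf
    have hE' := mul_mem_mor hXm (mul_mem_mor hE hXm')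
    have hVV : X.submatrix id (Subtype.val : {i // P i} → r.ι) *
        (X.submatrix id (Subtype.val : {i // P i} → r.ι))ᴴ =
          X * diagonal (fun i => if P i then 1 else 0) * Xᴴ := by
      ext i j
      rw [Matrix.mul_apply, Matrix.mul_apply]
      simp only [mul_diagonal, conjTranspose_apply, submatrix_apply, id_eq,
        mul_ite, mul_one, mul_zero, ite_mul, zero_mul]
      rw [← Finset.sum_filter]
      exact (Finset.sum_subtype (Finset.univ.filter P) (by simp)
        fun k => X i k * star (X j k)).symm
    have hV : (X.submatrix id (Subtype.val : {i // P i} → r.ι))ᴴ *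
        X.submatrix id (Subtype.val : {i // P i} → r.ι) = 1 := by
      rw [conjTranspose_submatrix, ← submatrix_mul Xᴴ X _ _ _ Function.bijective_id, hXX, submatrix_one _ Subtype.val_injective]
    have hp : X.submatrix id (Subtype.val : {i // P i} → r.ι) *
        (X.submatrix id (Subtype.val : {i // P i} → r.ι))ᴴ ∈ Mor r r := by
      rw [hVV, Matrix.mul_assoc]
      exact hE'
    exact ⟨r.compress _ hV hp, _, r.mem_mor_compress _ hV hp, rfl, hVV⟩
  obtain ⟨i, j, hij⟩ : ∃ i j, d i ≠ d j := by
    by_contra! H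
    rcases isEmpty_or_nonempty r.ι with h | ⟨⟨i⟩⟩
    · exact hne 0 (Subsingleton.elim _ _)
    · apply hne (d i)
      rw [hspec, show d = fun _ => d i from funext fun j => H j i,
        ← smul_one_eq_diagonal, Matrix.mul_smul, Matrix.mul_one, Matrix.smul_mul, hXX']
  -- Split off one eigenspace. Index `j` is missing from it and `i` from its complement, so both
  -- dimensions drop.
  obtain ⟨s, V, hV, hs, hVV⟩ := block (fun k => d k = d i) fun k l h => by simp only [h]
  obtain ⟨t, W, hW, ht, hWW⟩ := block (fun k => ¬ d k = d i) fun k l h => by simp only [h]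
  refine ⟨s, t, V, W, hV, hW, ?_, ?_, ?_⟩
  · rw [hs]
    exact Fintype.card_subtype_lt (x := j) (Ne.symm hij)
  · rw [ht]
    exact Fintype.card_subtype_lt (x := i) (not_not.2 rfl)
  · rw [hVV, hWW, ← Matrix.add_mul, ← Matrix.mul_add, diagonal_add]
    have : (fun k => (if d k = d i then (1 : ℂ) else 0) + if ¬ d k = d i then 1 else 0) =
        fun _ => 1 := by
      funext k
      by_cases h : d k = d i <;> simp [h]
    rw [this, diagonal_one, Matrix.mul_one, hXX']

/-- Every finite-dimensional unitary representation is a direct sum of irreducible ones. -/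
theorem FinRep.exists_irred_decomposition (r : G.FinRep) :
    ∃ (J : Type) (_ : Fintype J) (S : J → Σ x : Irred G, Matrix r.ι x.rep.ι ℂ),
      (∀ j, (S j).2 ∈ Mor (S j).1.rep r) ∧ ∑ j, (S j).2 * (S j).2ᴴ = 1 := by
  induction hn : Fintype.card r.ι using Nat.strong_induction_on generalizing r with
  | _ n ih =>
    by_cases hr : r.IsIrreducible
    · obtain ⟨T, hT, -, h2⟩ : (Irred.rep (Quotient.mk (irredSetoid G) ⟨r, hr⟩)).Equivalent r :=
        Quotient.exact (Quotient.out_eq (Quotient.mk (irredSetoid G) ⟨r, hr⟩))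
      exact ⟨Unit, inferInstance, fun _ => ⟨_, T⟩, fun _ => hT, by simpa using h2⟩
    -- Irreducibility demands a nonzero space; the zero representation is the empty sum.
    rcases isEmpty_or_nonempty r.ι with h | h
    · exact ⟨Empty, inferInstance, fun x => x.elim, fun x => x.elim, Subsingleton.elim _ _⟩
    obtain ⟨T, hT, hT'⟩ : ∃ T ∈ Mor r r, ∀ c : ℂ, T ≠ c • (1 : Matrix r.ι r.ι ℂ) := by
      by_contra! H
      refine hr ⟨h, Set.ext fun T => ⟨H T, ?_⟩⟩
      rintro ⟨c, rfl⟩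
      exact smul_one_mem_mor r c
    obtain ⟨s, t, V, W, hV, hW, hs, ht, hVW⟩ := r.exists_decomposition hT hT'
    obtain ⟨J, _, S, hS, hS'⟩ := ih _ (hn ▸ hs) s rfl
    obtain ⟨J', _, S', hT, hT'⟩ := ih _ (hn ▸ ht) t rfl
    refine ⟨J ⊕ J', inferInstance, Sum.elim (fun j => ⟨(S j).1, V * (S j).2⟩)
      (fun j => ⟨(S' j).1, W * (S' j).2⟩), ?_, ?_⟩
    · rintro (j | j)
      · exact mul_mem_mor hV (hS j)
      · exact mul_mem_mor hW (hT j)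
    · have aux : ∀ {m n k : Type} [Fintype m] [Fintype n] [Fintype k] (A : Matrix k m ℂ)
          (B : Matrix m n ℂ), A * B * (A * B)ᴴ = A * (B * Bᴴ) * Aᴴ := by
        intros
        simp only [conjTranspose_mul, Matrix.mul_assoc]
      rw [Fintype.sum_sum_type]
      refine (congrArg₂ (· + ·) (Finset.sum_congr rfl fun j _ => aux V (S j).2)
        (Finset.sum_congr rfl fun j _ => aux W (S' j).2)).trans ?_
      simp only [← Matrix.sum_mul, ← Matrix.mul_sum, hS', hT', Matrix.mul_one, hVW]

/-- A one-letter word is `u^x ⊗ 1`, whose index type has an extra `Unit` factor to absorb. -/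
theorem submatrix_fst_mem_mor {x : Irred G} {r : G.FinRep} {S : Matrix r.ι x.rep.ι ℂ}
    (hS : S ∈ Mor x.rep r) :
    (S.submatrix id Prod.fst : Matrix r.ι (x.rep.ι × Unit) ℂ) ∈ Mor (Irred.prod [x]) r := by
  rw [mem_mor_iff] at *
  ext i ⟨j, k⟩
  have h := congrFun (congrFun hS i) j
  simp only [Matrix.mul_apply, Matrix.map_apply] at h ⊢
  refine Eq.trans ?_ h
  change ∑ p : x.rep.ι × Unit, _ = _
  rw [Fintype.sum_prod_type]
  refine Finset.sum_congr rfl fun l _ => ?_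
  rw [Fintype.sum_unique]
  refine congrArg₂ _ rfl ?_
  refine (kronecker_one_mul_apply _ _ _ _).trans ?_
  exact (congrArg _ (one_apply_eq ())).trans (mul_one _)

theorem isGenerating_univ (G : CompactQuantumGroup.{u}) :
    IsGenerating (Set.univ : Set (Irred G)) := by
  intro r
  obtain ⟨J, _, S, hS, hS'⟩ := r.exists_irred_decomposition
  let e := (Fintype.equivFin J).symm
  refine ⟨Fintype.card J, fun k => [(S (e k)).1], fun k => (S (e k)).2.submatrix id Prod.fst,
    fun _ _ _ => Set.mem_univ _, fun k => submatrix_fst_mem_mor (hS (e k)), ?_⟩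
  rw [← hS', ← e.sum_comp]
  refine Finset.sum_congr rfl fun k _ => ?_
  ext i j
  simp only [Matrix.mul_apply]
  change ∑ p : (S (e k)).1.rep.ι × Unit, _ = _
  rw [Fintype.sum_prod_type]
  refine Finset.sum_congr rfl fun l _ => ?_
  rw [Fintype.sum_unique]
  rfl

theorem DualFiniteDimensional.finite_irred (hG : G.DualFiniteDimensional) : Finite (Irred G) := by
  have (x : Irred G) : Nonempty x.rep.ι := (Quotient.out x).2.1
  exact lp.finite_of_finiteDimensional (E := fun x : Irred G => x.space →L[ℂ] x.space) hG

end CompactQuantumGroup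

/-! ### Slices of operator matrices by vector functionals -/

namespace CompactQuantumGroup

open Matrix

variable {K : Type v} [NormedAddCommGroup K] [InnerProductSpace ℂ K]
  {ι κ : Type} [Fintype ι] [Fintype κ]

theorem norm_vecTensor (η : EuclideanSpace ℂ ι) (ξ : K) : ‖vecTensor η ξ‖ = ‖η‖ * ‖ξ‖ := by
  refine (sq_eq_sq₀ (norm_nonneg _) (by positivity)).1 ?_
  rw [PiLp.norm_sq_eq_of_L2, mul_pow, EuclideanSpace.norm_sq_eq, Finset.sum_mul]
  exact Finset.sum_congr rfl fun i _ => by simp [vecTensor, norm_smul, mul_pow]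

/-- The slice `(ω_η ⊗ id)(M)` of `M = ∑ e_ij ⊗ M_ij` by the functional `a ↦ ⟪η, a η⟫`. -/
def vecSlice (M : Matrix ι ι (K →L[ℂ] K)) (η : EuclideanSpace ℂ ι) : K →L[ℂ] K :=
  ∑ i, ∑ j, (star (η i) * η j) • M i j

theorem inner_vecTensor_matAct (M : Matrix ι ι (K →L[ℂ] K)) (η : EuclideanSpace ℂ ι) (ξ ζ : K) :
    inner ℂ (vecTensor η ξ) (matAct M (vecTensor η ζ)) = inner ℂ ξ (vecSlice M η ζ) := by
  simp only [PiLp.inner_apply, vecTensor, matAct, vecSlice, _root_.sum_apply, _root_.smul_apply,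
    inner_sum, inner_smul_left, inner_smul_right, map_smul, mul_assoc]
  refine Finset.sum_congr rfl fun i _ => Finset.sum_congr rfl fun j _ => ?_
  rw [mul_left_comm]
  rfl

theorem vecSlice_smul (M : Matrix ι ι (K →L[ℂ] K)) (c : ℝ) (η : EuclideanSpace ℂ ι) :
    vecSlice M (c • η) = (c ^ 2) • vecSlice M η := by
  simp only [vecSlice, Finset.smul_sum]
  refine Finset.sum_congr rfl fun i _ => Finset.sum_congr rfl fun j _ => ?_
  rw [← Complex.coe_smul (c ^ 2), smul_smul]
  congr 1
  simp only [PiLp.smul_apply, Complex.real_smul, star_mul', Complex.star_def, Complex.conj_ofReal,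
    Complex.ofReal_pow]
  ring

theorem vecSlice_sum {J : Type*} (s : Finset J) (M : J → Matrix ι ι (K →L[ℂ] K))
    (η : EuclideanSpace ℂ ι) :
    vecSlice (∑ j ∈ s, M j) η = ∑ j ∈ s, vecSlice (M j) η := by
  simp only [vecSlice, Matrix.sum_apply, Finset.smul_sum]
  rw [Finset.sum_comm (s := s)]
  exact Finset.sum_congr rfl fun i _ => Finset.sum_comm

/-- This is `⟪η, S a Sᴴ η⟫ = ⟪Sᴴ η, a Sᴴ η⟫` in the first leg; scalar entries commute with the
operators. -/
theorem vecSlice_conj (S : Matrix ι κ ℂ) (M : Matrix κ κ (K →L[ℂ] K)) (η : EuclideanSpace ℂ ι) :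
    vecSlice (S.map (algebraMap ℂ (K →L[ℂ] K)) * M * Sᴴ.map (algebraMap ℂ (K →L[ℂ] K))) η =
      vecSlice M (WithLp.toLp 2 (Sᴴ *ᵥ η.ofLp)) := by
  have entry (i j : ι) :
      (S.map (algebraMap ℂ (K →L[ℂ] K)) * M * Sᴴ.map (algebraMap ℂ (K →L[ℂ] K))) i j =
        ∑ k, ∑ l, (S i k * star (S j l)) • M k l := by
    simp only [Matrix.mul_apply, Matrix.map_apply, conjTranspose_apply, Finset.sum_mul]
    rw [Finset.sum_comm]
    refine Finset.sum_congr rfl fun k _ => Finset.sum_congr rfl fun l _ => ?_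
    rw [← Algebra.commutes, ← Algebra.smul_def, ← Algebra.smul_def, smul_smul, mul_comm]
  simp only [vecSlice, entry, mulVec, dotProduct, conjTranspose_apply, star_sum,
    Finset.sum_mul_sum, Finset.sum_smul, Finset.smul_sum, smul_smul]
  have swap (f : ι → ι → κ → κ → (K →L[ℂ] K)) :
      ∑ i, ∑ j, ∑ k, ∑ l, f i j k l = ∑ k, ∑ l, ∑ i, ∑ j, f i j k l := by
    have h : ∑ p : ι × ι, ∑ q : κ × κ, f p.1 p.2 q.1 q.2 =
        ∑ q : κ × κ, ∑ p : ι × ι, f p.1 p.2 q.1 q.2 := Finset.sum_comm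
    simpa only [Fintype.sum_prod_type] using h
  rw [swap]
  refine Finset.sum_congr rfl fun k _ => Finset.sum_congr rfl fun l _ =>
    Finset.sum_congr rfl fun i _ => Finset.sum_congr rfl fun j _ => ?_
  congr 1
  rw [star_mul', star_star]
  ring

/-- The tensor product of two vectors in coordinates. -/
def vecMul (η : EuclideanSpace ℂ ι) (θ : EuclideanSpace ℂ κ) : EuclideanSpace ℂ (ι × κ) :=
  WithLp.toLp 2 fun p => η p.1 * θ p.2

theorem norm_vecMul (η : EuclideanSpace ℂ ι) (θ : EuclideanSpace ℂ κ) :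
    ‖vecMul η θ‖ = ‖η‖ * ‖θ‖ := by
  refine (sq_eq_sq₀ (norm_nonneg _) (by positivity)).1 ?_
  rw [mul_pow, EuclideanSpace.norm_sq_eq, EuclideanSpace.norm_sq_eq, EuclideanSpace.norm_sq_eq,
    Finset.sum_mul_sum, Fintype.sum_prod_type]
  simp [vecMul, mul_pow]

/-- The functional `ω_η ⊗ ω_θ` is `ω_{η ⊗ θ}`, here applied to `M₁₃ N₂₃`. -/
theorem vecSlice_mul [DecidableEq ι] [DecidableEq κ] (M : Matrix ι ι (K →L[ℂ] K))
    (N : Matrix κ κ (K →L[ℂ] K)) (η : EuclideanSpace ℂ ι) (θ : EuclideanSpace ℂ κ) :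
    vecSlice M η * vecSlice N θ =
      vecSlice ((M ⊗ₖ (1 : Matrix κ κ (K →L[ℂ] K))) * ((1 : Matrix ι ι (K →L[ℂ] K)) ⊗ₖ N))
        (vecMul η θ) := by
  simp only [vecSlice, kronecker_one_mul_apply, Fintype.sum_prod_type, vecMul,
    Finset.sum_mul_sum, smul_mul_smul_comm]
  refine Finset.sum_congr rfl fun i _ => Finset.sum_congr rfl fun k _ =>
    Finset.sum_congr rfl fun j _ => Finset.sum_congr rfl fun l _ => ?_
  congr 1
  rw [star_mul']
  ring

theorem continuous_vecSlice (M : Matrix ι ι (K →L[ℂ] K)) : Continuous (vecSlice M) := by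
  unfold vecSlice
  fun_prop

/-- The left side is `⟪η, (∑ S_j S_jᴴ) η⟫`. For a unit vector these squares become the weights of a
convex combination. -/
theorem sum_norm_sq_conjTranspose_mulVec [DecidableEq ι] {J : Type*} [Fintype J] {κ : J → Type}
    [∀ j, Fintype (κ j)] (S : ∀ j, Matrix ι (κ j) ℂ) (hS : ∑ j, S j * (S j)ᴴ = 1)
    (η : EuclideanSpace ℂ ι) :
    ∑ j, ‖(WithLp.toLp 2 ((S j)ᴴ *ᵥ η.ofLp) : EuclideanSpace ℂ (κ j))‖ ^ 2 = ‖η‖ ^ 2 := by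
  have key : ∀ {α : Type} [Fintype α] (v : EuclideanSpace ℂ α),
      ((‖v‖ ^ 2 : ℝ) : ℂ) = star v.ofLp ⬝ᵥ v.ofLp := by
    intro α _ v
    rw [EuclideanSpace.norm_sq_eq, Complex.ofReal_sum]
    refine Finset.sum_congr rfl fun i _ => ?_
    rw [Pi.star_apply, Complex.star_def, Complex.conj_mul', Complex.ofReal_pow]
  apply Complex.ofReal_injective
  rw [Complex.ofReal_sum, key η]
  calc _ = ∑ j, star η.ofLp ⬝ᵥ ((S j * (S j)ᴴ) *ᵥ η.ofLp) := by
        refine Finset.sum_congr rfl fun j _ => (key _).trans ?_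
        rw [star_mulVec, conjTranspose_conjTranspose, ← dotProduct_mulVec, mulVec_mulVec]
    _ = _ := by rw [← dotProduct_sum, ← sum_mulVec, hS, one_mulVec]

/-- Multiplying `W` by `∑ S_j S_jᴴ = 1` gives `W = ∑ S_j N_j S_jᴴ`, to be sliced term by term. -/
theorem vecSlice_eq_sum [DecidableEq ι] {J : Type*} [Fintype J] {κ : J → Type}
    [∀ j, Fintype (κ j)] (S : ∀ j, Matrix ι (κ j) ℂ) (hS : ∑ j, S j * (S j)ᴴ = 1)
    {W : Matrix ι ι (K →L[ℂ] K)} (N : ∀ j, Matrix (κ j) (κ j) (K →L[ℂ] K))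
    (hW : ∀ j, W * (S j).map (algebraMap ℂ (K →L[ℂ] K)) =
      (S j).map (algebraMap ℂ (K →L[ℂ] K)) * N j) (η : EuclideanSpace ℂ ι) :
    vecSlice W η = ∑ j, vecSlice (N j) (WithLp.toLp 2 ((S j)ᴴ *ᵥ η.ofLp)) := by
  have h1 : ∑ j, (S j).map (algebraMap ℂ (K →L[ℂ] K)) *
      (S j)ᴴ.map (algebraMap ℂ (K →L[ℂ] K)) = 1 := by
    have h := congrArg (algebraMap ℂ (K →L[ℂ] K)).mapMatrix hS
    rw [map_sum, map_one] at h
    exact (Finset.sum_congr rfl fun j _ => Matrix.map_mul.symm).trans h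
  have h2 : W = ∑ j, (S j).map (algebraMap ℂ (K →L[ℂ] K)) * N j *
      (S j)ᴴ.map (algebraMap ℂ (K →L[ℂ] K)) := by
    simp only [← hW, Matrix.mul_assoc]
    rw [← Matrix.mul_sum, h1, Matrix.mul_one]
  rw [h2, vecSlice_sum]
  exact Finset.sum_congr rfl fun j _ => vecSlice_conj _ _ _

theorem matAct_mul (M N : Matrix ι ι (K →L[ℂ] K)) (v : PiLp 2 (fun _ : ι => K)) :
    matAct (M * N) v = matAct M (matAct N v) := by
  ext i
  simp only [matAct, Matrix.mul_apply, _root_.sum_apply, mul_apply_eq_comp, map_sum]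
  exact Finset.sum_comm

theorem matAct_one [DecidableEq ι] (v : PiLp 2 (fun _ : ι => K)) : matAct 1 v = v := by
  ext i
  simp only [matAct, Matrix.one_apply]
  rw [Finset.sum_eq_single i] <;> simp +contextual [eq_comm]

variable [CompleteSpace K]

theorem inner_matAct (M : Matrix ι ι (K →L[ℂ] K)) (v w : PiLp 2 (fun _ : ι => K)) :
    inner ℂ v (matAct M w) = inner ℂ (matAct Mᴴ v) w := by
  simp only [PiLp.inner_apply, matAct, inner_sum, sum_inner, conjTranspose_apply,
    ContinuousLinearMap.star_eq_adjoint, ContinuousLinearMap.adjoint_inner_left]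
  exact Finset.sum_comm

theorem norm_matAct [DecidableEq ι] {M : Matrix ι ι (K →L[ℂ] K)}
    (hM : M ∈ unitary (Matrix ι ι (K →L[ℂ] K))) (v : PiLp 2 (fun _ : ι => K)) :
    ‖matAct M v‖ = ‖v‖ := by
  have h : inner ℂ (matAct M v) (matAct M v) = inner ℂ v v := by
    rw [inner_matAct, ← matAct_mul, ← star_eq_conjTranspose, (Unitary.mem_iff.1 hM).1, matAct_one]
  rw [@norm_eq_sqrt_re_inner ℂ, h, ← @norm_eq_sqrt_re_inner ℂ]

theorem norm_vecSlice_le [DecidableEq ι] {M : Matrix ι ι (K →L[ℂ] K)}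
    (hM : M ∈ unitary (Matrix ι ι (K →L[ℂ] K))) {η : EuclideanSpace ℂ ι} (hη : ‖η‖ = 1) (ζ : K) :
    ‖vecSlice M η ζ‖ ≤ ‖ζ‖ := by
  -- Testing against the slice `s` itself makes Cauchy–Schwarz read `‖s‖² ≤ ‖s‖ ‖ζ‖`.
  have h := norm_inner_le_norm (𝕜 := ℂ) (vecTensor η (vecSlice M η ζ)) (matAct M (vecTensor η ζ))
  rw [inner_vecTensor_matAct, norm_matAct hM, norm_vecTensor, norm_vecTensor, hη, one_mul, one_mul,
    inner_self_eq_norm_sq_to_K, norm_pow, RCLike.norm_ofReal, abs_norm, sq] at h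
  rcases (norm_nonneg (vecSlice M η ζ)).eq_or_lt with h0 | h0
  · rw [← h0]
    exact norm_nonneg _
  · exact le_of_mul_le_mul_left h h0

theorem norm_matAct_sub_sq [DecidableEq ι] {M : Matrix ι ι (K →L[ℂ] K)}
    (hM : M ∈ unitary (Matrix ι ι (K →L[ℂ] K))) (η : EuclideanSpace ℂ ι) (ζ : K) :
    ‖matAct M (vecTensor η ζ) - vecTensor η ζ‖ ^ 2 =
      2 * (‖η‖ ^ 2 * ‖ζ‖ ^ 2) - 2 * (inner ℂ ζ (vecSlice M η ζ)).re := by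
  rw [@norm_sub_sq ℂ, norm_matAct hM, ← inner_vecTensor_matAct, norm_vecTensor, inner_re_symm]
  simp only [RCLike.re_eq_complex_re]
  ring

end CompactQuantumGroup

/-! ### The convex hull of the orbit and its point of least norm -/

namespace CompactQuantumGroup

open Matrix

variable {G : CompactQuantumGroup.{u}} {K : Type v} [NormedAddCommGroup K] [InnerProductSpace ℂ K]
  [CompleteSpace K]

/-- The comultiplication rule says that `U₁₃ U₂₃` restricts to `U^x` on each irreducible component
of `u^y ⊗ u^z`; the components of `η ⊗ θ` are the new vectors. -/
theorem DualRep.exists_vecSlice_mul_eq (U : DualRep G K) (y z : Irred G) (η : y.space)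
    (θ : z.space) :
    ∃ (J : Type) (_ : Fintype J) (v : J → Σ x : Irred G, x.space),
      ∑ j, ‖(v j).2‖ ^ 2 = (‖η‖ * ‖θ‖) ^ 2 ∧
      vecSlice (U.U y) η * vecSlice (U.U z) θ = ∑ j, vecSlice (U.U (v j).1) (v j).2 := by
  obtain ⟨J, _, S, hS, hS'⟩ := (FinRep.tensor y.rep z.rep).exists_irred_decomposition
  refine ⟨J, inferInstance, fun j => ⟨(S j).1, WithLp.toLp 2 ((S j).2ᴴ *ᵥ (vecMul η θ).ofLp)⟩,
    ?_, ?_⟩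
  · rw [← norm_vecMul]
    exact sum_norm_sq_conjTranspose_mulVec (ι := y.rep.ι × z.rep.ι) (fun j => (S j).2) hS' _
  · rw [vecSlice_mul]
    exact vecSlice_eq_sum (ι := y.rep.ι × z.rep.ι) (fun j => (S j).2) hS'
      (fun j => U.U (S j).1) (fun j => U.comul (S j).1 y z (S j).2 (hS j)) _

/-- The vectors `(ω ⊗ id)(U) ξ`, where `ω` is a pure state of a matrix block of `l^∞(Ĝ)`. -/
def DualRep.stateOrbit (U : DualRep G K) (ξ : K) : Set K :=
  {ζ | ∃ (x : Irred G) (η : x.space), ‖η‖ = 1 ∧ vecSlice (U.U x) η ξ = ζ}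

theorem DualRep.vecSlice_mem_closedConvexHull (U : DualRep G K) (ξ : K) {y : Irred G} {η : y.space}
    (hη : ‖η‖ = 1) {ζ : K} (hζ : ζ ∈ closedConvexHull ℝ (U.stateOrbit ξ)) :
    vecSlice (U.U y) η ζ ∈ closedConvexHull ℝ (U.stateOrbit ξ) := by
  have hconv : Convex ℝ (closedConvexHull ℝ (U.stateOrbit ξ)) := convex_closedConvexHull
  let T : K →L[ℝ] K := (vecSlice (U.U y) η).restrictScalars ℝ
  suffices h : closedConvexHull ℝ (U.stateOrbit ξ) ⊆
      T ⁻¹' (closedConvexHull ℝ (U.stateOrbit ξ)) from h hζ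
  -- The preimage of the hull under `T` is closed and convex, so checking orbit points suffices.
  refine closedConvexHull_min ?_ (hconv.is_linear_preimage T.toLinearMap.isLinear)
    (isClosed_closedConvexHull.preimage T.continuous)
  rintro _ ⟨z, θ, hθ, rfl⟩
  obtain ⟨J, _, v, hv, hv'⟩ := U.exists_vecSlice_mul_eq y z η θ
  have e : T (vecSlice (U.U z) θ ξ) = ∑ j, vecSlice (U.U (v j).1) (v j).2 ξ := by
    change (vecSlice (U.U y) η * vecSlice (U.U z) θ) ξ = _
    rw [hv', _root_.sum_apply]
  rw [Set.mem_preimage, e]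
  have hb : vecSlice (U.U z) θ ξ ∈ closedConvexHull ℝ (U.stateOrbit ξ) :=
    subset_closedConvexHull ⟨z, θ, hθ, rfl⟩
  have hj : ∀ j, ∃ ζ ∈ closedConvexHull ℝ (U.stateOrbit ξ),
      vecSlice (U.U (v j).1) (v j).2 ξ = (‖(v j).2‖ ^ 2) • ζ := by
    intro j
    by_cases h0 : (v j).2 = 0
    -- A zero component has weight zero, so any point of the hull will do.
    · refine ⟨_, hb, ?_⟩
      rw [h0]
      simp [vecSlice]
    · refine ⟨_, subset_closedConvexHull ⟨(v j).1, (‖(v j).2‖)⁻¹ • (v j).2, ?_, rfl⟩, ?_⟩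
      · rw [norm_smul, norm_inv, norm_norm, inv_mul_cancel₀ (norm_ne_zero_iff.2 h0)]
      · rw [← _root_.smul_apply, ← vecSlice_smul, smul_smul,
          mul_inv_cancel₀ (norm_ne_zero_iff.2 h0), one_smul]
  choose ζ hζ hζ' using hj
  simp only [hζ']
  refine hconv.sum_mem (fun j _ => by positivity) ?_ fun j _ => hζ j
  rw [hv, hη, hθ, one_mul, one_pow]

/-- The variational inequality `⟪v, w - v⟫ ≥ 0` gives `‖w - v‖² ≤ ‖w‖² - ‖v‖²`. -/
theorem eq_of_mem_of_norm_le_of_convex {E : Type*} [NormedAddCommGroup E] [InnerProductSpace ℝ E]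
    {C : Set E} (hC : Convex ℝ C) {v w : E} (hv : v ∈ C) (hw : w ∈ C)
    (hmin : ‖(0 : E) - v‖ = ⨅ x : C, ‖(0 : E) - x‖) (hle : ‖w‖ ≤ ‖v‖) : w = v := by
  have h := (norm_eq_iInf_iff_real_inner_le_zero hC hv).1 hmin w hw
  rw [zero_sub, inner_neg_left, inner_sub_right, real_inner_self_eq_norm_sq] at h
  have h2 := norm_sub_sq_real w v
  rw [real_inner_comm] at h2
  have h3 : ‖w‖ ^ 2 ≤ ‖v‖ ^ 2 := by gcongr
  have h4 : ‖w - v‖ ^ 2 ≤ 0 := by linarith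
  exact sub_eq_zero.1 (norm_eq_zero.1 (pow_eq_zero_iff two_ne_zero |>.1
    (le_antisymm h4 (sq_nonneg _))))

/-- Fixed slices push `Re ⟪η ⊗ ζ, U^x (η ⊗ ζ)⟫` to its maximum `‖η‖² ‖ζ‖²`, so the displacement
vanishes. -/
theorem DualRep.matAct_vecTensor_eq_of_vecSlice_eq (U : DualRep G K) {ζ : K}
    (h : ∀ (x : Irred G) (η : x.space), ‖η‖ = 1 → vecSlice (U.U x) η ζ = ζ)
    (x : Irred G) (η : x.space) : matAct (U.U x) (vecTensor η ζ) = vecTensor η ζ := by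
  have hs : vecSlice (U.U x) η ζ = (‖η‖ ^ 2) • ζ := by
    by_cases h0 : η = 0
    · simp [h0, vecSlice]
    · have h1 := h x ((‖η‖)⁻¹ • η) <| by
        rw [norm_smul, norm_inv, norm_norm, inv_mul_cancel₀ (norm_ne_zero_iff.2 h0)]
      rw [vecSlice_smul, _root_.smul_apply, inv_pow] at h1
      rw [← inv_smul_eq_iff₀ (pow_ne_zero 2 (norm_ne_zero_iff.2 h0)), h1]
  have e := norm_matAct_sub_sq (U.mem_unitary x) η ζ
  have hr : (inner ℂ ζ ((‖η‖ ^ 2) • ζ)).re = ‖η‖ ^ 2 * ‖ζ‖ ^ 2 := by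
    rw [← Complex.coe_smul, inner_smul_right, Complex.re_ofReal_mul]
    congr 1
    exact inner_self_eq_norm_sq (𝕜 := ℂ) ζ
  rw [hs, hr, sub_self, pow_eq_zero_iff two_ne_zero, norm_eq_zero, sub_eq_zero] at e
  exact e

theorem DualRep.hasNonzeroInvariantVector_of_sqrt_two [Finite (Irred G)] (U : DualRep G K)
    (hU : U.HasInvariantVectorUpTo Set.univ (Real.sqrt 2)) : U.HasNonzeroInvariantVector := by
  obtain ⟨ξ, hξ, hinv⟩ := hU
  let _ : InnerProductSpace ℝ K := InnerProductSpace.rclikeToReal ℂ K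
  have hpos (x : Irred G) (η : x.space) (hη : ‖η‖ = 1) :
      0 < (inner ℂ ξ (vecSlice (U.U x) η ξ)).re := by
    have h := hinv x (Set.mem_univ x) η (norm_ne_zero_iff.1 (by rw [hη]; exact one_ne_zero))
    have h2 := pow_lt_pow_left₀ h (norm_nonneg _) two_ne_zero
    rw [norm_matAct_sub_sq (U.mem_unitary x), hη, hξ, mul_one, Real.sq_sqrt zero_le_two] at h2
    linarith
  -- Compactness of the unit sphere of `H_x` makes positivity uniform in `η`; finiteness of `Irred
  -- G` then makes it uniform in `x`.
  have hδ (x : Irred G) : ∃ δ : ℝ, 0 < δ ∧ ∀ η ∈ Metric.sphere (0 : x.space) 1,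
      δ ≤ (inner ℂ ξ (vecSlice (U.U x) η ξ)).re := by
    refine (isCompact_sphere (0 : x.space) 1).exists_forall_le' ?_ fun η hη =>
      hpos x η (mem_sphere_zero_iff_norm.1 hη)
    have := continuous_vecSlice (U.U x)
    fun_prop
  choose δ hδpos hδ using hδ
  have : Nonempty (Irred G) := ⟨Irred.one G⟩
  obtain ⟨x₀, hx₀⟩ := Finite.exists_min δ
  set C := closedConvexHull ℝ (U.stateOrbit ξ)
  have hconv : Convex ℝ C := convex_closedConvexHull
  have hclosed : IsClosed C := isClosed_closedConvexHull
  have hhalf : ∀ ζ ∈ C, δ x₀ ≤ (inner ℂ ξ ζ).re := by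
    let φ : K →L[ℝ] ℝ := Complex.reCLM.comp ((innerSL ℂ ξ).restrictScalars ℝ)
    refine closedConvexHull_min (t := {ζ | δ x₀ ≤ φ ζ}) ?_
      (convex_halfSpace_ge φ.toLinearMap.isLinear _) (isClosed_le continuous_const φ.continuous)
    rintro _ ⟨x, η, hη, rfl⟩
    exact (hx₀ x).trans (hδ x η (mem_sphere_zero_iff_norm.2 hη))
  have hne : C.Nonempty := by
    have : Nonempty x₀.rep.ι := (Quotient.out x₀).2.1
    obtain ⟨η, hη⟩ := exists_norm_eq x₀.space zero_le_one
    exact ⟨_, subset_closedConvexHull ⟨x₀, η, hη, rfl⟩⟩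
  obtain ⟨ζ, hζ, hmin⟩ := exists_norm_eq_iInf_of_complete_convex hne hclosed.isComplete hconv 0
  refine ⟨ζ, ?_, U.matAct_vecTensor_eq_of_vecSlice_eq fun x η hη => ?_⟩
  -- The half-space containing `C` omits `0`.
  · rintro rfl
    have := hhalf 0 hζ
    rw [inner_zero_right, Complex.zero_re] at this
    exact absurd (hδpos x₀) this.not_gt
  · exact eq_of_mem_of_norm_le_of_convex hconv hζ (U.vecSlice_mem_closedConvexHull ξ hη hζ) hmin
      (norm_vecSlice_le (U.mem_unitary x) hη ζ)

end CompactQuantumGroup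

theorem proposition10 (G : CompactQuantumGroup.{u}) (hG : G.DualFiniteDimensional) :
    CompactQuantumGroup.IsKazhdanPair.{u, v} G Set.univ (Real.sqrt 2) ∧
      CompactQuantumGroup.HasPropertyT.{u, v} G := by
  have : Finite G.Irred := hG.finite_irred
  refine ⟨⟨Set.finite_univ, Set.mem_univ _, CompactQuantumGroup.isGenerating_univ G,
    Real.sqrt_pos.2 two_pos, fun K _ _ _ U hU => U.hasNonzeroInvariantVector_of_sqrt_two hU⟩, ?_⟩
  intro K _ _ _ U hU
  -- As `Irred G` is finite, almost invariance may be tested on all of it at once with `ε = √2`.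
  exact U.hasNonzeroInvariantVector_of_sqrt_two
    (hU _ Set.finite_univ _ (Real.sqrt_pos.2 two_pos))

end
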